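/- Let $S$ be a once-punctured torus, with $\pi_1(S)=\langle a,b\rangle$ free of rank two and $[a,b]$ a loop around the puncture. Let $X_{par}(S)$ be the set of conjugacy classes $[\rho]$ of irreducible representations $\rho:\pi_1(S)\to \mathrm{PSL}(2,\mathbb{C})$ such that $\rho([a,b])$ is parabolic. A discrete subgroup $\Gamma<\mathrm{PSL}(2,\mathbb{C})$ has limit set $\Lambda(\Gamma)\subset\mathbb{C}P^1$, the set of accumulation points in $\partial_\infty\mathbb{H}^3\cong\mathbb{C}P^1$ of an orbit $\Gamma p$, $p\in\mathbb{H}^3$. A representation $\rho$ is called quasi-Fuchsian if it is faithful, its image $\Gamma$ is discrete, and $\mathbb{C}P^1\setminus\Lambda(\Gamma)$ consists of exactly two open (topological) disks. Let $\mathcal{QF}(S)\subset X_{par}(S)$ be the set of classes of quasi-Fuchsian representations and, for $l>0$, let $\mathcal{QF}(l)$ be the set of $[\rho]\in\mathcal{QF}(S)$ for which $\rho(a)$ has complex length $l$ (mod $2\pi\sqrt{-1}\,\mathbb{Z}$), i.e. $\rho(a)$ is conjugate to $\pm\begin{pmatrix} e^{l/2} & * \\ 0 & e^{-l/2}\end{pmatrix}$.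 For $\mathrm{Re}(\lambda)>0$ and $\tau\in\mathbb{C}$ let $\psi_{FN}(\lambda,\tau)\in X_{par}(S)$ be the class with complex Fenchel–Nielsen coordinates $(\lambda,\tau)$, namely the class of the representation with $$\rho(a)=\begin{pmatrix} e_1 & 2e_1^{-1}\\ 0& e_1^{-1}\end{pmatrix},\qquad \rho(b)=\frac{1}{\sqrt{t_1}\,(e_1^2-1)}\begin{pmatrix}(e_1^2+1)t_1+2 & -2(t_1+1)\\ -e_1^2+1& e_1^2-1\end{pmatrix},$$ where $e_1=e^{\lambda/2}$, $t_1=e^{\tau}$, $\sqrt{t_1}=e^{\tau/2}$; equivalently, a lift to $\mathrm{SL}(2,\mathbb{C})$ satisfies $(\mathrm{tr}\,\rho(a),\mathrm{tr}\,\rho(b),\mathrm{tr}\,\rho(ab))=\left(2\cosh\tfrac{\lambda}{2},\ \frac{2\cosh(\tau/2)}{\tanh(\lambda/2)},\ \frac{2\cosh((\tau+\lambda)/2)}{\tanh(\lambda/2)}\right)$. **Proposition.** Let $l>0$. If $\tau\in\mathbb{C}$ and $|\mathrm{Im}(\tau)|=\pi$, then $\psi_{FN}(l,\tau)$ is not quasi-Fuchsian,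 i.e. $\psi_{FN}(l,\tau)\notin\mathcal{QF}(S)$. In particular, every element of $\mathcal{QF}(l)$ is $\psi_{FN}(l,\tau)$ for some $\tau$ with $-\pi<\mathrm{Im}(\tau)<\pi$; and, regarding $\mathcal{QF}(l)$ via $\psi_{FN}$ as a subset of $\{(l,\tau) : -\pi\le \mathrm{Im}(\tau)<\pi\}$, $$\mathcal{QF}(l)\subset\{l\}\times\{\tau\in\mathbb{C} : -\pi<\mathrm{Im}(\tau)<\pi\}.$$ -/

import Mathlib

open scoped commutatorElement MatrixGroups

/-- The group `SL(2, ℂ)`. -/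
abbrev SL2C : Type := Matrix.SpecialLinearGroup (Fin 2) ℂ

/-- The group `PSL(2, ℂ) = SL(2, ℂ) / {1, -1}`, with the quotient topology. -/
abbrev PSL2C : Type := Matrix.ProjectiveSpecialLinearGroup (Fin 2) ℂ

/-- The fundamental group of the once-punctured torus `S`: the free group on two generators `a`, `b`
whose commutator `[a, b]` is a loop around the puncture. -/
abbrev PuncturedTorusGroup : Type := FreeGroup (Fin 2)

namespace PuncturedTorusGroup

/-- The generator `a`; its conjugacy class is the simple closed curve `1/0`. -/
def a : PuncturedTorusGroup := FreeGroup.of 0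

/-- The generator `b`; its conjugacy class is the simple closed curve `0/1`. -/
def b : PuncturedTorusGroup := FreeGroup.of 1

/-- The loop around the puncture. -/
def peripheral : PuncturedTorusGroup := ⁅a, b⁆

end PuncturedTorusGroup

/-! ### Hyperbolic three-space, limit sets, quasi-Fuchsian groups -/

/-- Upper half-space `{(z, t) : t > 0}`, the model of hyperbolic three-space. -/
def UpperHalfSpace : Set (ℂ × ℝ) := {p | 0 < p.2}

/-- The isometric action of a matrix of `SL(2, ℂ)` on upper half-space (Poincaré extension of the
Möbius transformation `z ↦ (a z + b) / (c z + d)`). -/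
noncomputable def poincareExtension (M : SL2C) (p : ℂ × ℝ) : ℂ × ℝ :=
  let den : ℝ := ‖M 1 0 * p.1 + M 1 1‖ ^ 2 + ‖M 1 0‖ ^ 2 * p.2 ^ 2
  (((M 0 0 * p.1 + M 0 1) * (starRingEnd ℂ) (M 1 0 * p.1 + M 1 1)
      + M 0 0 * (starRingEnd ℂ) (M 1 0) * (p.2 : ℂ) ^ 2) / (den : ℂ),
    p.2 / den)

/-- The orbit of a point of upper half-space under a subgroup of `PSL(2, ℂ)`. -/
def hypOrbit (Γ : Subgroup PSL2C) (p : ℂ × ℝ) : Set (ℂ × ℝ) :=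
  {q | ∃ M : SL2C, (M : PSL2C) ∈ Γ ∧ q = poincareExtension M p}

/-- The Riemann sphere `ℂ ∪ {∞}` as the ideal boundary of upper half-space, inside the one-point
compactification of `ℂ × ℝ`. -/
def idealBoundary : OnePoint ℂ → OnePoint (ℂ × ℝ) := OnePoint.map (fun z : ℂ => (z, (0 : ℝ)))

/-- The limit set: the accumulation points, in the ideal boundary, of the orbit of a point of
hyperbolic three-space. -/
def limitSet (Γ : Subgroup PSL2C) : Set (OnePoint ℂ) :=
  {ξ | ∃ p ∈ UpperHalfSpace,
    AccPt (idealBoundary ξ)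
      (Filter.principal ((fun q : ℂ × ℝ => (q : OnePoint (ℂ × ℝ))) '' hypOrbit Γ p))}

/-- The domain of discontinuity: the complement of the limit set in the Riemann sphere. -/
def domainOfDiscontinuity (Γ : Subgroup PSL2C) : Set (OnePoint ℂ) := (limitSet Γ)ᶜ

/-- An open (topological) disk in the Riemann sphere. -/
def IsOpenDisk (U : Set (OnePoint ℂ)) : Prop :=
  IsOpen U ∧ Nonempty (U ≃ₜ Metric.ball (0 : ℂ) 1)

/-- A quasi-Fuchsian group: a discrete subgroup of `PSL(2, ℂ)` whose domain of discontinuity consists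
of exactly two open disks. (That the group is isomorphic to the surface group is part of the
faithfulness of a quasi-Fuchsian representation below.) -/
def IsQuasiFuchsianGroup (Γ : Subgroup PSL2C) : Prop :=
  DiscreteTopology Γ ∧
    ∃ U V : Set (OnePoint ℂ), IsOpenDisk U ∧ IsOpenDisk V ∧ Disjoint U V ∧
      domainOfDiscontinuity Γ = U ∪ V

/-- A quasi-Fuchsian representation: faithful, with quasi-Fuchsian image. -/
def IsQuasiFuchsianRep (ρ : PuncturedTorusGroup →* PSL2C) : Prop :=
  Function.Injective ρ ∧ IsQuasiFuchsianGroup ρ.range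

/-! ### The character variety and the linear slices -/

/-- A parabolic element of `PSL(2, ℂ)`: not the identity, of trace `±2`. -/
def IsParabolicElt (g : PSL2C) : Prop :=
  g ≠ 1 ∧ ∃ M : SL2C, (M : PSL2C) = g ∧ (M : Matrix (Fin 2) (Fin 2) ℂ).trace ^ 2 = 4

/-- Irreducible: no common fixed point on the complex projective line. -/
def IsIrreducibleRep (ρ : PuncturedTorusGroup →* PSL2C) : Prop :=
  ¬ ∃ ξ : Projectivization ℂ (Fin 2 → ℂ), ∀ g, ρ g • ξ = ξ

/-- The irreducible representations of the punctured torus group taking the loop around the puncture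
(hence every nontrivial peripheral element) to a parabolic element. -/
def RparIrr : Type :=
  {ρ : PuncturedTorusGroup →* PSL2C //
    IsParabolicElt (ρ PuncturedTorusGroup.peripheral) ∧ IsIrreducibleRep ρ}

/-- Conjugacy of representations by an element of `PSL(2, ℂ)`. -/
instance RparIrr.conjSetoid : Setoid RparIrr where
  r ρ σ := ∃ h : PSL2C, ∀ g, σ.1 g = h * ρ.1 g * h⁻¹
  iseqv :=
    { refl := fun ρ => ⟨1, fun g => by simp⟩
      symm := by
        rintro ρ σ ⟨h, hh⟩
        exact ⟨h⁻¹, fun g => by rw [hh g]; group⟩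
      trans := by
        rintro ρ σ θ ⟨h, hh⟩ ⟨k, hk⟩
        exact ⟨k * h, fun g => by rw [hk g, hh g]; group⟩ }

/-- The character variety `X_par(S)`: conjugacy classes of irreducible representations whose
peripheral elements are parabolic. -/
def Xpar : Type := Quotient RparIrr.conjSetoid

/-- The conjugacy class of a representation. -/
def Xpar.mk (ρ : RparIrr) : Xpar := Quotient.mk RparIrr.conjSetoid ρ

/-- `QF(S)`: the conjugacy classes of quasi-Fuchsian representations. -/
def QF : Set Xpar := {x | ∃ ρ : RparIrr, Xpar.mk ρ = x ∧ IsQuasiFuchsianRep ρ.1}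

/-- `g` has complex length `lam` (modulo `2πi`, and up to sign): `g` is conjugate to the class of an
upper triangular matrix with diagonal entries `exp (lam / 2)` and `exp (-lam / 2)`. -/
def HasComplexLength (g : PSL2C) (lam : ℂ) : Prop :=
  ∃ (h : PSL2C) (M : SL2C), g = h * (M : PSL2C) * h⁻¹ ∧ M 1 0 = 0 ∧
    M 0 0 = Complex.exp (lam / 2) ∧ M 1 1 = Complex.exp (-lam / 2)

/-- The linear slice `X(lam)` of the curve `1/0`. -/
def linearSlice (lam : ℂ) : Set Xpar :=
  {x | ∃ ρ : RparIrr, Xpar.mk ρ = x ∧ HasComplexLength (ρ.1 PuncturedTorusGroup.a) lam}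

/-- The linear slice `QF(lam) = QF(S) ∩ X(lam)` of quasi-Fuchsian space. -/
def QFSlice (lam : ℂ) : Set Xpar := QF ∩ linearSlice lam

/-! ### Complex Fenchel-Nielsen coordinates -/

section FenchelNielsen

theorem exp_half_sq_sub_one_ne {lam : ℂ} (h : 0 < lam.re) : Complex.exp (lam / 2) ^ 2 - 1 ≠ 0 := by
  intro h0
  have h1 : Complex.exp lam = 1 := by
    have := sub_eq_zero.mp h0
    rwa [← Complex.exp_nat_mul, show ((2 : ℕ) : ℂ) * (lam / 2) = lam by push_cast; ring] at this
  have h2 := congrArg norm h1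
  rw [Complex.norm_exp, norm_one, Real.exp_eq_one_iff] at h2
  linarith

theorem exp_half_sq_add_one_ne {lam : ℂ} (h : 0 < lam.re) : Complex.exp (lam / 2) ^ 2 + 1 ≠ 0 := by
  intro h0
  have h1 : Complex.exp lam = -1 := by
    have := eq_neg_of_add_eq_zero_left h0
    rwa [← Complex.exp_nat_mul, show ((2 : ℕ) : ℂ) * (lam / 2) = lam by push_cast; ring] at this
  have h2 := congrArg norm h1
  rw [Complex.norm_exp, norm_neg, norm_one, Real.exp_eq_one_iff] at h2
  linarith

/-- The matrix of `a` at the point `(lam, tau)`, with `E = exp (lam / 2)`. -/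
noncomputable def fnA (lam : ℂ) : SL2C :=
  ⟨!![Complex.exp (lam / 2), 2 * (Complex.exp (lam / 2))⁻¹; 0, (Complex.exp (lam / 2))⁻¹], by
    rw [Matrix.det_fin_two_of, mul_zero, sub_zero, mul_inv_cancel₀ (Complex.exp_ne_zero _)]⟩

/-- The matrix of `b` at the point `(lam, tau)`, with `E = exp (lam / 2)` and `T = exp (tau / 2)`. -/
noncomputable def fnB (lam tau : ℂ) (h : 0 < lam.re) : SL2C :=
  let E := Complex.exp (lam / 2)
  let T := Complex.exp (tau / 2)
  ⟨!![((E ^ 2 + 1) * T ^ 2 + 2) / (T * (E ^ 2 - 1)), -2 * (T ^ 2 + 1) / (T * (E ^ 2 - 1));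
      (-E ^ 2 + 1) / (T * (E ^ 2 - 1)), (E ^ 2 - 1) / (T * (E ^ 2 - 1))], by
    have hE : E ^ 2 - 1 ≠ 0 := exp_half_sq_sub_one_ne h
    have hT : T ≠ 0 := Complex.exp_ne_zero _
    rw [Matrix.det_fin_two_of]
    field_simp
    ring⟩

/-- The lift to `SL(2, ℂ)` of the representation with Fenchel-Nielsen coordinates `(lam, tau)`. -/
noncomputable def fnLift (lam tau : ℂ) (h : 0 < lam.re) : PuncturedTorusGroup →* SL2C :=
  FreeGroup.lift ![fnA lam, fnB lam tau h]

/-- The representation with Fenchel-Nielsen coordinates `(lam, tau)`. -/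
noncomputable def fnRep (lam tau : ℂ) (h : 0 < lam.re) : PuncturedTorusGroup →* PSL2C :=
  (QuotientGroup.mk' (Subgroup.center SL2C)).comp (fnLift lam tau h)

theorem fnLift_a (lam tau : ℂ) (h : 0 < lam.re) :
    fnLift lam tau h PuncturedTorusGroup.a = fnA lam := by
  simp [fnLift, PuncturedTorusGroup.a]

theorem fnLift_b (lam tau : ℂ) (h : 0 < lam.re) :
    fnLift lam tau h PuncturedTorusGroup.b = fnB lam tau h := by
  simp [fnLift, PuncturedTorusGroup.b]

/-- The lift has the traces that define the Fenchel-Nielsen coordinates: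
`tr a = 2 cosh (lam / 2)`, `tr b = 2 cosh (tau / 2) / tanh (lam / 2)` and
`tr ab = 2 cosh ((tau + lam) / 2) / tanh (lam / 2)`. -/
theorem fnLift_traces (lam tau : ℂ) (h : 0 < lam.re) :
    (fnLift lam tau h PuncturedTorusGroup.a : Matrix (Fin 2) (Fin 2) ℂ).trace
        = 2 * Complex.cosh (lam / 2) ∧
    (fnLift lam tau h PuncturedTorusGroup.b : Matrix (Fin 2) (Fin 2) ℂ).trace
        = 2 * Complex.cosh (tau / 2) / Complex.tanh (lam / 2) ∧
    (fnLift lam tau h (PuncturedTorusGroup.a * PuncturedTorusGroup.b) :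
        Matrix (Fin 2) (Fin 2) ℂ).trace
        = 2 * Complex.cosh ((tau + lam) / 2) / Complex.tanh (lam / 2) := by
  have hE := exp_half_sq_sub_one_ne h
  have hE' := exp_half_sq_add_one_ne h
  have hE0 := Complex.exp_ne_zero (lam / 2)
  have hT0 := Complex.exp_ne_zero (tau / 2)
  rw [map_mul, fnLift_a, fnLift_b, add_div, Complex.tanh_eq_sinh_div_cosh]
  simp only [Complex.cosh, Complex.sinh, Complex.exp_neg, Complex.exp_add]
  rw [Matrix.SpecialLinearGroup.coe_mul]
  simp only [fnA, fnB, Matrix.mul_fin_two, Matrix.trace_fin_two_of]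
  generalize Complex.exp (lam / 2) = E at *
  generalize Complex.exp (tau / 2) = T at *
  have h1 : E - E⁻¹ ≠ 0 := by
    intro h0; apply hE; field_simp at h0; simpa using h0
  have h2 : E + E⁻¹ ≠ 0 := by
    intro h0; apply hE'; field_simp at h0; simpa using h0
  refine ⟨?_, ?_, ?_⟩ <;> (field_simp; try ring)

theorem fnRep_parabolic (lam tau : ℂ) (h : 0 < lam.re) :
    IsParabolicElt (fnRep lam tau h PuncturedTorusGroup.peripheral) := by
  have hE := exp_half_sq_sub_one_ne h
  have hE' := exp_half_sq_add_one_ne h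
  have hE0 := Complex.exp_ne_zero (lam / 2)
  have hT0 := Complex.exp_ne_zero (tau / 2)
  have hper : fnLift lam tau h PuncturedTorusGroup.peripheral
      = fnA lam * fnB lam tau h * (fnA lam)⁻¹ * (fnB lam tau h)⁻¹ := by
    rw [PuncturedTorusGroup.peripheral, map_commutatorElement, fnLift_a, fnLift_b,
      commutatorElement_def]
  refine ⟨?_, _, rfl, ?_⟩
  · intro h1
    have h2 : fnLift lam tau h PuncturedTorusGroup.peripheral ∈ Subgroup.center SL2C :=
      (QuotientGroup.eq_one_iff _).mp h1
    obtain ⟨r, hr, hM⟩ := Matrix.SpecialLinearGroup.mem_center_iff.mp h2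
    rw [Fintype.card_fin] at hr
    have h3 : fnLift lam tau h PuncturedTorusGroup.peripheral * (fnB lam tau h * fnA lam)
        = fnA lam * fnB lam tau h := by
      rw [hper]; group
    have h3' := congrArg (fun M : SL2C => (M : Matrix (Fin 2) (Fin 2) ℂ)) h3
    rw [Matrix.SpecialLinearGroup.coe_mul, Matrix.SpecialLinearGroup.coe_mul,
      Matrix.SpecialLinearGroup.coe_mul, ← hM, Matrix.scalar_apply, ← Matrix.smul_eq_diagonal_mul]
      at h3'
    have h4 := congrFun (congrFun h3' 1) 0
    simp only [fnA, fnB, Matrix.mul_fin_two, Matrix.smul_apply, Matrix.of_apply, smul_eq_mul,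
      Matrix.cons_val', Matrix.cons_val_zero, Matrix.cons_val_one, Matrix.cons_val_fin_one] at h4
    generalize Complex.exp (lam / 2) = E at *
    generalize Complex.exp (tau / 2) = T at *
    simp at h4
    have h5 : r * E ^ 2 = 1 := by
      have hq : -E ^ 2 + 1 ≠ 0 := by
        intro h0; apply hE; linear_combination -h0
      field_simp at h4
      exact h4
    have h6 : (E ^ 2 - 1) * (E ^ 2 + 1) = 0 := by
      linear_combination (r * E ^ 2 + 1) * h5 - E ^ 4 * hr
    exact (mul_ne_zero hE hE') h6
  · rw [hper]
    have ht : ((fnA lam * fnB lam tau h * (fnA lam)⁻¹ * (fnB lam tau h)⁻¹ : SL2C) :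
        Matrix (Fin 2) (Fin 2) ℂ).trace = -2 := by
      rw [Matrix.SpecialLinearGroup.coe_mul, Matrix.SpecialLinearGroup.coe_mul,
        Matrix.SpecialLinearGroup.coe_mul, Matrix.SpecialLinearGroup.coe_inv,
        Matrix.SpecialLinearGroup.coe_inv]
      simp only [fnA, fnB, Matrix.adjugate_fin_two_of, Matrix.mul_fin_two, Matrix.trace_fin_two_of]
      generalize Complex.exp (lam / 2) = E at *
      generalize Complex.exp (tau / 2) = T at *
      field_simp
      ring
    rw [ht]; norm_num

theorem fnRep_irreducible (lam tau : ℂ) (h : 0 < lam.re) : IsIrreducibleRep (fnRep lam tau h) := by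
  have hE := exp_half_sq_sub_one_ne h
  have hE0 := Complex.exp_ne_zero (lam / 2)
  have hT0 := Complex.exp_ne_zero (tau / 2)
  rintro ⟨ξ, hξ⟩
  induction ξ using Projectivization.ind with
  | h v hv =>
  have key : ∀ g, ∃ c : ℂ,
      (fnLift lam tau h g : Matrix (Fin 2) (Fin 2) ℂ).mulVec v = c • v := by
    intro g
    have h1 := hξ g
    have h2 : (fnLift lam tau h g) • Projectivization.mk ℂ v hv = Projectivization.mk ℂ v hv := h1
    rw [Projectivization.smul_mk, Projectivization.mk_eq_mk_iff'] at h2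
    obtain ⟨c, hc⟩ := h2
    exact ⟨c, hc.symm⟩
  obtain ⟨c, hc⟩ := key PuncturedTorusGroup.a
  obtain ⟨d, hd⟩ := key PuncturedTorusGroup.b
  rw [fnLift_a] at hc
  rw [fnLift_b] at hd
  have hc0 := congrFun hc 0
  have hc1 := congrFun hc 1
  have hd0 := congrFun hd 0
  have hd1 := congrFun hd 1
  simp only [fnA, fnB, Matrix.mulVec, dotProduct, Fin.sum_univ_two, Matrix.of_apply,
    Matrix.cons_val', Matrix.cons_val_zero, Matrix.cons_val_one, Matrix.cons_val_fin_one,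
    Pi.smul_apply, smul_eq_mul, zero_mul, zero_add] at hc0 hc1 hd0 hd1
  have hv' : ¬ (v 0 = 0 ∧ v 1 = 0) := by
    rintro ⟨h0, h1⟩
    exact hv (by ext i; fin_cases i <;> assumption)
  generalize v 0 = x at *
  generalize v 1 = y at *
  generalize Complex.exp (lam / 2) = E at *
  generalize Complex.exp (tau / 2) = T at *
  by_cases hy : y = 0
  · subst hy
    have hx : x ≠ 0 := fun hx => hv' ⟨hx, rfl⟩
    field_simp at hd1
    simp at hd1
    rcases hd1 with hd1 | hd1
    · exact hE (by linear_combination -hd1)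
    · exact hx hd1
  · have hcE : c = E⁻¹ := (mul_right_cancel₀ hy hc1).symm
    subst hcE
    have hx : (E ^ 2 - 1) * x = -2 * y := by
      field_simp at hc0
      linear_combination hc0
    field_simp at hd0 hd1
    have hd' : T * d * (E ^ 2 - 1) = E ^ 2 + 1 := by
      apply mul_right_cancel₀ hy
      linear_combination -hd1 - hx
    have hfin : (4 * E ^ 2 * T ^ 2) * y = 0 := by
      have e1 := hd0
      linear_combination (-(E ^ 2 - 1)) * e1 + ((E ^ 2 + 1) * T ^ 2 + 2) * hx
        - (x * (E ^ 2 - 1)) * hd' - (E ^ 2 + 1) * hx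
    exact (mul_ne_zero (mul_ne_zero (mul_ne_zero (by norm_num) (pow_ne_zero 2 hE0))
      (pow_ne_zero 2 hT0)) hy) hfin

/-- The complex Fenchel-Nielsen parametrization `psi_FN`, with values in the character variety. -/
noncomputable def psiFN (lam tau : ℂ) (h : 0 < lam.re) : Xpar :=
  Xpar.mk ⟨fnRep lam tau h, fnRep_parabolic lam tau h, fnRep_irreducible lam tau h⟩

/-- The linear slice `QF(l)` in Fenchel-Nielsen coordinates, that is, as a subset of
`{(l, tau) : -π ≤ Im tau < π}`, the coordinate model of the linear slice `X(l)`. -/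
def QFSliceCoord (l : ℝ) (hl : 0 < l) : Set (ℂ × ℂ) :=
  {p | p.1 = (l : ℂ) ∧ -Real.pi ≤ p.2.im ∧ p.2.im < Real.pi ∧ psiFN l p.2 hl ∈ QFSlice l}

end FenchelNielsen

open Filter Topology

/-! When `|Im τ| = π`, the trace formulas make `tr a = x` real and `tr b = iy`, `tr ab = iz` purely
imaginary, and commutator trace -2 becomes `y² + z² - xyz = x²`. The claim is that no discrete
faithful representation has such traces; the shape of the domain of discontinuity plays no role.

The proof is a descent over generating pairs. If `xyz > 0`, a Dehn twist about `u` replaces the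
larger of `|y|`, `|z|` by something smaller; if `xyz < 0`, the other Vieta move does the same to
`|x|`. So a reducing move always exists, and the real form of the triple is preserved
(`abs_twist_le`, `abs_flip_le`). Discreteness makes each drop at least 1/4: Shimizu's lemma applied
to the parabolic commutator gives `|y|, |z| ≥ 1/2` (`half_le_norm_trace`), and `|x| ≥ 2` because a
discrete torsion-free group has no elliptics (`exists_pow_eq_one_of_abs_trace_lt_two`). Infinite
descent of a positive quantity by steps of 1/4 is impossible.

For the two inclusions, an irreducible pair with parabolic commutator and prescribed length of `a`
is conjugated to Fenchel–Nielsen form (`exists_psiFN_eq`), with `Im τ` in `(-π, π]`; the first claim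
removes the boundary line. -/

/-! ### Discreteness and Shimizu's lemma -/

theorem eventually_mk_eq_one (Γ : Subgroup PSL2C) [DiscreteTopology Γ] :
    ∀ᶠ M : SL2C in 𝓝 1, (M : PSL2C) ∈ Γ → (M : PSL2C) = 1 := by
  obtain ⟨V, hV, hV1⟩ := isOpen_induced_iff.mp (isOpen_discrete ({1} : Set Γ))
  have h1 : (1 : PSL2C) ∈ V := by
    have : (1 : Γ) ∈ Subtype.val ⁻¹' V := by rw [hV1]; rfl
    exact this
  have hc : Continuous (fun M : SL2C => (M : PSL2C)) := continuous_quot_mk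
  filter_upwards [(hV.preimage hc).mem_nhds (show (1 : SL2C) ∈ _ from h1)] with M hM hMΓ
  have : (⟨(M : PSL2C), hMΓ⟩ : Γ) ∈ Subtype.val ⁻¹' V := hM
  rw [hV1] at this
  exact congrArg Subtype.val this

/-- The matrix of `SL(2, ℂ)` with rows `(a, b)` and `(c, d)`. -/
def SL2C.of (a b c d : ℂ) (h : a * d - b * c = 1) : SL2C :=
  ⟨!![a, b; c, d], by rw [Matrix.det_fin_two_of, h]⟩

@[simp] theorem SL2C.coe_of (a b c d : ℂ) (h : a * d - b * c = 1) :
    (SL2C.of a b c d h : Matrix (Fin 2) (Fin 2) ℂ) = !![a, b; c, d] := rfl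

/-- The translation `z ↦ z + 1`. -/
def unitTranslation : SL2C := SL2C.of 1 1 0 1 (by norm_num)

@[simp] theorem coe_unitTranslation :
    (unitTranslation : Matrix (Fin 2) (Fin 2) ℂ) = !![1, 1; 0, 1] := rfl

theorem SL2C.tendsto_iff {ι : Type*} {l : Filter ι} {f : ι → SL2C} {M : SL2C} :
    Tendsto f l (𝓝 M) ↔ ∀ i j, Tendsto (fun n => f n i j) l (𝓝 (M i j)) :=
  (Topology.IsInducing.subtypeVal.tendsto_nhds_iff).trans <|
    tendsto_pi_nhds.trans <| forall_congr' fun _ => tendsto_pi_nhds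

theorem SL2C.mul_apply (M N : SL2C) (i j : Fin 2) :
    (M * N) i j = M i 0 * N 0 j + M i 1 * N 1 j := by
  rw [Matrix.SpecialLinearGroup.coe_mul, Matrix.mul_apply, Fin.sum_univ_two]

theorem SL2C.coe_inv (M : SL2C) :
    ((M⁻¹ : SL2C) : Matrix (Fin 2) (Fin 2) ℂ) = !![M 1 1, -M 0 1; -M 1 0, M 0 0] := by
  rw [Matrix.SpecialLinearGroup.coe_inv, Matrix.adjugate_fin_two]

theorem SL2C.ext_entries {M N : SL2C} (h00 : M 0 0 = N 0 0) (h01 : M 0 1 = N 0 1)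
    (h10 : M 1 0 = N 1 0) (h11 : M 1 1 = N 1 1) : M = N := by
  apply Subtype.ext
  ext i j
  fin_cases i <;> fin_cases j <;> assumption

theorem SL2C.det_eq (M : SL2C) : M 0 0 * M 1 1 - M 0 1 * M 1 0 = 1 := by
  rw [← Matrix.det_fin_two, M.det_coe]

/-- The conjugator has columns `(P - 1)w` and `w`, where `w` is a multiple `t` of a standard basis
vector not fixed by `P`; a square root supplies the `t` that makes its determinant one. -/
theorem exists_conj_unitTranslation {P : SL2C}
    (htr : (P : Matrix (Fin 2) (Fin 2) ℂ).trace = 2) (hP : P ≠ 1) :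
    ∃ h : SL2C, P = h * unitTranslation * h⁻¹ := by
  have hdet := SL2C.det_eq P
  rw [Matrix.trace_fin_two] at htr
  have key : ∀ h : SL2C, P * h = h * unitTranslation → P = h * unitTranslation * h⁻¹ :=
    fun h hh => by rw [← hh, mul_inv_cancel_right]
  have hd : P 1 1 = 2 - P 0 0 := by linear_combination htr
  rw [hd] at hdet
  by_cases hc : P 1 0 = 0
  · have ha : P 0 0 = 1 := by
      have : (P 0 0 - 1) ^ 2 = 0 := by rw [hc] at hdet; linear_combination -hdet
      exact sub_eq_zero.mp (pow_eq_zero_iff (two_ne_zero) |>.mp this)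
    have hb : P 0 1 ≠ 0 := by
      intro hb
      apply hP
      apply SL2C.ext_entries <;> simp [hb, hc, ha, hd]
      norm_num
    obtain ⟨t, ht⟩ := IsAlgClosed.exists_pow_nat_eq (P 0 1)⁻¹ (n := 2) (by norm_num)
    have ht' : t ^ 2 * P 0 1 = 1 := by rw [ht, inv_mul_cancel₀ hb]
    refine ⟨SL2C.of (t * P 0 1) 0 0 t (by linear_combination ht'),
      key _ ?_⟩
    apply SL2C.ext_entries <;>
      simp [SL2C.mul_apply, hc, ha, hd] <;> ring
  · obtain ⟨t, ht⟩ := IsAlgClosed.exists_pow_nat_eq (-(P 1 0)⁻¹) (n := 2) (by norm_num)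
    have ht' : t ^ 2 * P 1 0 = -1 := by rw [ht, neg_mul, inv_mul_cancel₀ hc]
    refine ⟨SL2C.of (t * (P 0 0 - 1)) t (t * P 1 0) 0 (by linear_combination -ht'), key _ ?_⟩
    apply SL2C.ext_entries <;> simp [SL2C.mul_apply, hd]
    · linear_combination (-t) * hdet
    · ring
    · ring
    · ring

theorem conj_unitTranslation_apply (M : SL2C) :
    ((M * unitTranslation * M⁻¹ : SL2C) : Matrix (Fin 2) (Fin 2) ℂ)
      = !![1 - M 0 0 * M 1 0, M 0 0 ^ 2; -M 1 0 ^ 2, 1 + M 0 0 * M 1 0] := by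
  have hdet := SL2C.det_eq M
  rw [Matrix.SpecialLinearGroup.coe_mul, Matrix.SpecialLinearGroup.coe_mul, SL2C.coe_inv]
  ext i j
  fin_cases i <;> fin_cases j <;>
    simp [Matrix.mul_apply, Fin.sum_univ_two]
  · linear_combination hdet
  · ring
  · ring
  · linear_combination hdet

/-- Iterated conjugation of the unit translation, starting from `M`. -/
noncomputable def shimizuSeq (M : SL2C) : ℕ → SL2C
  | 0 => M
  | n + 1 => shimizuSeq M n * unitTranslation * (shimizuSeq M n)⁻¹

theorem shimizuSeq_succ_apply (M : SL2C) (n : ℕ) :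
    (shimizuSeq M (n + 1) : Matrix (Fin 2) (Fin 2) ℂ) =
      !![1 - shimizuSeq M n 0 0 * shimizuSeq M n 1 0, shimizuSeq M n 0 0 ^ 2;
        -shimizuSeq M n 1 0 ^ 2, 1 + shimizuSeq M n 0 0 * shimizuSeq M n 1 0] :=
  conj_unitTranslation_apply _

theorem shimizuSeq_ne_zero {M : SL2C} (h : M 1 0 ≠ 0) (n : ℕ) : shimizuSeq M n 1 0 ≠ 0 := by
  induction n with
  | zero => exact h
  | succ n ih => simpa [shimizuSeq_succ_apply] using ih

/-- The lower left entry obeys `c ↦ -c²`, so it tends to 0 once `|c| < 1`; the upper left entry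
obeys `a ↦ 1 - ac`, hence stays bounded and tends to 1. -/
theorem tendsto_shimizuSeq {M : SL2C} (h : ‖M 1 0‖ < 1) :
    Tendsto (fun n => shimizuSeq M (n + 1)) atTop (𝓝 unitTranslation) := by
  set r := ‖M 1 0‖
  have hr0 : 0 ≤ r := norm_nonneg _
  have hc : ∀ n, ‖shimizuSeq M n 1 0‖ ≤ r ^ (n + 1) := by
    intro n
    induction n with
    | zero => simp [shimizuSeq, r]
    | succ n ih =>
      rw [shimizuSeq_succ_apply]
      simp only [Matrix.of_apply, Matrix.cons_val', Matrix.cons_val_zero, Matrix.cons_val_one,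
        Matrix.cons_val_fin_one, norm_neg, norm_pow]
      calc ‖shimizuSeq M n 1 0‖ ^ 2 ≤ (r ^ (n + 1)) ^ 2 := by gcongr
        _ = r ^ (n + 1 + 1) * r ^ n := by ring
        _ ≤ r ^ (n + 1 + 1) := mul_le_of_le_one_right (by positivity) (pow_le_one₀ hr0 h.le)
  -- `K` is chosen so that the disk of radius `K` is preserved by `a ↦ 1 - ac` whenever `|c| ≤ r`.
  obtain ⟨K, hK0, hK1⟩ : ∃ K, ‖M 0 0‖ ≤ K ∧ 1 + r * K ≤ K := by
    refine ⟨max ‖M 0 0‖ (1 / (1 - r)), le_max_left _ _, ?_⟩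
    have h1 : 0 < 1 - r := by linarith
    have h2 := (div_le_iff₀ h1).mp (le_max_right ‖M 0 0‖ (1 / (1 - r)))
    linarith
  have ha : ∀ n, ‖shimizuSeq M n 0 0‖ ≤ K := by
    intro n
    induction n with
    | zero => exact hK0
    | succ n ih =>
      rw [shimizuSeq_succ_apply]
      simp only [Matrix.of_apply, Matrix.cons_val', Matrix.cons_val_zero,
        Matrix.cons_val_fin_one]
      have h1 : ‖shimizuSeq M n 1 0‖ ≤ r := (hc n).trans (by
        rw [pow_succ]; exact mul_le_of_le_one_left hr0 (pow_le_one₀ hr0 h.le))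
      calc _ ≤ ‖(1 : ℂ)‖ + ‖shimizuSeq M n 0 0 * shimizuSeq M n 1 0‖ := norm_sub_le _ _
        _ = 1 + ‖shimizuSeq M n 1 0‖ * ‖shimizuSeq M n 0 0‖ := by rw [norm_mul, norm_one, mul_comm]
        _ ≤ 1 + r * K := by gcongr
        _ ≤ K := hK1
  have hpow : Tendsto (fun n : ℕ => r ^ (n + 1)) atTop (𝓝 0) :=
    (tendsto_pow_atTop_nhds_zero_of_lt_one hr0 h).comp (tendsto_add_atTop_nat 1)
  have hc0 : Tendsto (fun n => shimizuSeq M n 1 0) atTop (𝓝 0) :=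
    squeeze_zero_norm hc hpow
  have hac : Tendsto (fun n => shimizuSeq M n 0 0 * shimizuSeq M n 1 0) atTop (𝓝 0) := by
    refine squeeze_zero_norm (a := fun n : ℕ => K * r ^ (n + 1)) (fun n => ?_) ?_
    · rw [norm_mul]
      exact mul_le_mul (ha n) (hc n) (norm_nonneg _) ((norm_nonneg _).trans hK0)
    · simpa using hpow.const_mul K
  have ha1 : Tendsto (fun n => shimizuSeq M n 0 0) atTop (𝓝 1) := by
    rw [← tendsto_add_atTop_iff_nat 1]
    simpa [shimizuSeq_succ_apply] using hac.const_sub 1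
  rw [SL2C.tendsto_iff]
  intro i j
  fin_cases i <;> fin_cases j
  · simpa [shimizuSeq_succ_apply] using hac.const_sub 1
  · simpa [shimizuSeq_succ_apply] using ha1.pow 2
  · simpa [shimizuSeq_succ_apply] using (hc0.pow 2).neg
  · simpa [shimizuSeq_succ_apply] using hac.const_add 1

theorem apply_one_zero_of_mk_eq_one {M : SL2C} (h : (M : PSL2C) = 1) : M 1 0 = 0 := by
  obtain ⟨r, -, hr⟩ := Matrix.SpecialLinearGroup.mem_center_iff.mp
    ((QuotientGroup.eq_one_iff M).mp h)
  have := congrFun (congrFun hr 1) 0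
  simpa using this.symm

/-- **Shimizu's lemma**, in trace form. -/
theorem one_le_norm_trace_sub {Γ : Subgroup PSL2C} [DiscreteTopology Γ] {P M : SL2C}
    (hPΓ : (P : PSL2C) ∈ Γ) (hMΓ : (M : PSL2C) ∈ Γ)
    (htr : (P : Matrix (Fin 2) (Fin 2) ℂ).trace = 2) (hP : P ≠ 1)
    (hne : ((P * M : SL2C) : Matrix (Fin 2) (Fin 2) ℂ).trace
      ≠ (M : Matrix (Fin 2) (Fin 2) ℂ).trace) :
    1 ≤ ‖((P * M : SL2C) : Matrix (Fin 2) (Fin 2) ℂ).trace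
      - (M : Matrix (Fin 2) (Fin 2) ℂ).trace‖ := by
  obtain ⟨h, rfl⟩ := exists_conj_unitTranslation htr hP
  set N := h⁻¹ * M * h with hN
  have hconj : ∀ X : SL2C, ((h * X * h⁻¹ : SL2C) : Matrix (Fin 2) (Fin 2) ℂ).trace
      = (X : Matrix (Fin 2) (Fin 2) ℂ).trace := by
    intro X
    rw [Matrix.SpecialLinearGroup.coe_mul, Matrix.trace_mul_comm,
      ← Matrix.SpecialLinearGroup.coe_mul, inv_mul_cancel_left]
  have hM : M = h * N * h⁻¹ := by rw [hN]; group
  have hdiff : ((h * unitTranslation * h⁻¹ * M : SL2C) : Matrix (Fin 2) (Fin 2) ℂ).trace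
      - (M : Matrix (Fin 2) (Fin 2) ℂ).trace = N 1 0 := by
    rw [show h * unitTranslation * h⁻¹ * M = h * (unitTranslation * N) * h⁻¹ by rw [hN]; group,
      hconj]
    conv_lhs => rw [hM]
    rw [hconj, Matrix.SpecialLinearGroup.coe_mul, Matrix.trace_fin_two, Matrix.trace_fin_two]
    simp [Matrix.mul_apply, Fin.sum_univ_two]
  rw [hdiff]
  have hN0 : N 1 0 ≠ 0 := by rw [← hdiff]; exact sub_ne_zero.mpr hne
  by_contra! hlt
  have hmem : ∀ n, ((h * shimizuSeq N n * h⁻¹ : SL2C) : PSL2C) ∈ Γ := by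
    intro n
    induction n with
    | zero => rw [shimizuSeq, ← hM]; exact hMΓ
    | succ n ih =>
      have : h * shimizuSeq N (n + 1) * h⁻¹ = (h * shimizuSeq N n * h⁻¹)
          * (h * unitTranslation * h⁻¹) * (h * shimizuSeq N n * h⁻¹)⁻¹ := by
        rw [shimizuSeq]; group
      rw [this]
      exact Γ.mul_mem (Γ.mul_mem ih hPΓ) (Γ.inv_mem ih)
  have hlim : Tendsto (fun n => h * (unitTranslation⁻¹ * shimizuSeq N (n + 1)) * h⁻¹)
      atTop (𝓝 1) := by
    have h1 : Tendsto (fun n => h * (unitTranslation⁻¹ * shimizuSeq N (n + 1)) * h⁻¹)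
        atTop (𝓝 (h * (unitTranslation⁻¹ * unitTranslation) * h⁻¹)) :=
      ((((tendsto_shimizuSeq hlt).const_mul _).const_mul _).mul_const _)
    simpa using h1
  -- The iterates converge to the parabolic itself, so by discreteness some iterate equals it in the
  -- quotient; but their lower left entries never vanish.
  obtain ⟨n, hn⟩ := (hlim.eventually (eventually_mk_eq_one Γ)).exists
  have h1 : ((h * (unitTranslation⁻¹ * shimizuSeq N (n + 1)) * h⁻¹ : SL2C) : PSL2C) = 1 := by
    apply hn
    rw [show h * (unitTranslation⁻¹ * shimizuSeq N (n + 1)) * h⁻¹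
      = (h * unitTranslation * h⁻¹)⁻¹ * (h * shimizuSeq N (n + 1) * h⁻¹) by group]
    exact Γ.mul_mem (Γ.inv_mem hPΓ) (hmem _)
  have h2 : ((unitTranslation⁻¹ * shimizuSeq N (n + 1) : SL2C) : PSL2C) = 1 := by
    have h3 : ((h : PSL2C) * ((unitTranslation⁻¹ * shimizuSeq N (n + 1) : SL2C) : PSL2C)
      * (h : PSL2C)⁻¹) = 1 := h1
    exact conj_eq_one_iff.mp h3
  have h4 := apply_one_zero_of_mk_eq_one h2
  apply shimizuSeq_ne_zero hN0 (n + 1)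
  rw [Matrix.SpecialLinearGroup.coe_mul, Matrix.SpecialLinearGroup.coe_inv] at h4
  simpa [unitTranslation, Matrix.adjugate_fin_two_of, Matrix.mul_apply, Fin.sum_univ_two] using h4

/-! ### Trace identities -/

/-- The trace of a matrix of `SL(2, ℂ)`. -/
abbrev SL2C.tr (M : SL2C) : ℂ := (M : Matrix (Fin 2) (Fin 2) ℂ).trace

theorem SL2C.tr_eq (M : SL2C) : M.tr = M 0 0 + M 1 1 := Matrix.trace_fin_two _

theorem SL2C.tr_mul_comm (M N : SL2C) : (M * N).tr = (N * M).tr := by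
  rw [tr, tr, Matrix.SpecialLinearGroup.coe_mul, Matrix.trace_mul_comm,
    ← Matrix.SpecialLinearGroup.coe_mul]

theorem SL2C.tr_conj (M N : SL2C) : (M * N * M⁻¹).tr = N.tr := by
  rw [tr_mul_comm, inv_mul_cancel_left]

theorem SL2C.tr_inv (M : SL2C) : (M⁻¹).tr = M.tr := by
  rw [tr_eq, tr_eq, coe_inv]
  simp [add_comm]

theorem SL2C.tr_mul_add_tr_inv_mul (M N : SL2C) : (M * N).tr + (M⁻¹ * N).tr = M.tr * N.tr := by
  simp only [tr_eq, mul_apply, coe_inv]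
  simp
  ring

/-- Fricke's formula for the trace of a commutator. -/
theorem SL2C.tr_commutator (M N : SL2C) :
    (⁅M, N⁆ : SL2C).tr = M.tr ^ 2 + N.tr ^ 2 + (M * N).tr ^ 2 - M.tr * N.tr * (M * N).tr - 2 := by
  have h1 := tr_mul_add_tr_inv_mul M (N * M⁻¹ * N⁻¹)
  have h2 := tr_mul_add_tr_inv_mul (M⁻¹ * N) (M⁻¹ * N⁻¹)
  have h3 := tr_mul_add_tr_inv_mul M N
  have h4 := tr_mul_add_tr_inv_mul N N
  have h5 : (1 : SL2C).tr = 2 := by simp [tr_eq]; norm_num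
  rw [tr_conj, tr_inv, show M * (N * M⁻¹ * N⁻¹) = ⁅M, N⁆ by rw [commutatorElement_def]; group,
    show M⁻¹ * (N * M⁻¹ * N⁻¹) = M⁻¹ * N * (M⁻¹ * N⁻¹) by group] at h1
  rw [show (M⁻¹ * N)⁻¹ * (M⁻¹ * N⁻¹) = (N * N)⁻¹ by group, tr_inv,
    show M⁻¹ * N⁻¹ = (N * M)⁻¹ by group, tr_inv, tr_mul_comm N M] at h2
  rw [inv_mul_cancel, h5] at h4
  rw [show M⁻¹ * N⁻¹ = (N * M)⁻¹ by group] at h1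
  linear_combination h1 - h2 + h4 - (M * N).tr * h3

theorem SL2C.neg_one_mem_center : (-1 : SL2C) ∈ Subgroup.center SL2C := by
  rw [Subgroup.mem_center_iff]
  intro g
  rw [mul_neg, neg_mul, mul_one, one_mul]

theorem SL2C.mk_neg (M : SL2C) : ((-M : SL2C) : PSL2C) = M := by
  rw [QuotientGroup.eq]
  have : (-M)⁻¹ * M = -1 := by
    rw [inv_mul_eq_iff_eq_mul, mul_neg, mul_one, neg_neg]
  rw [this]
  exact neg_one_mem_center

theorem SL2C.tr_neg (M : SL2C) : (-M).tr = -M.tr := by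
  rw [tr, Matrix.SpecialLinearGroup.coe_neg, Matrix.trace_neg]

theorem SL2C.sq_eq_neg_one {M : SL2C} (h : M.tr = 0) : M ^ 2 = -1 := by
  have hd := det_eq M
  rw [tr_eq] at h
  have h' : M 1 1 = -M 0 0 := by linear_combination h
  rw [pow_two]
  apply ext_entries <;> rw [mul_apply, Matrix.SpecialLinearGroup.coe_neg] <;> simp [h'] <;>
    rw [h'] at hd
  · linear_combination -hd
  · ring
  · ring
  · linear_combination -hd

/-! ### Elliptic elements of discrete groups -/

/-- The coefficients of the powers of a matrix of determinant one and trace `x`. -/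
def chebyshevSeq (x : ℝ) : ℕ → ℝ
  | 0 => 0
  | 1 => 1
  | n + 2 => x * chebyshevSeq x (n + 1) - chebyshevSeq x n

/-- The form `p² - xpq + q²` is invariant under the recursion step `(p, q) ↦ (xp - q, p)`. For `|x|
< 2` it is positive definite, which bounds the sequence. -/
theorem chebyshevSeq_quadric (x : ℝ) (n : ℕ) :
    chebyshevSeq x (n + 1) ^ 2 - x * chebyshevSeq x (n + 1) * chebyshevSeq x n
      + chebyshevSeq x n ^ 2 = 1 := by
  induction n with
  | zero => simp [chebyshevSeq]
  | succ n ih => rw [chebyshevSeq]; linear_combination ih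

theorem exists_abs_chebyshevSeq_le {x : ℝ} (hx : |x| < 2) : ∃ C, ∀ n, |chebyshevSeq x n| ≤ C := by
  refine ⟨√(1 / (1 - |x| / 2)), fun n => Real.abs_le_sqrt ?_⟩
  have h := chebyshevSeq_quadric x n
  rw [le_div_iff₀ (by linarith)]
  set p := chebyshevSeq x (n + 1)
  set q := chebyshevSeq x n
  have h1 : x * p * q ≤ |x| * (|p| * |q|) := by
    rw [← abs_mul, ← abs_mul, ← mul_assoc]; exact le_abs_self _
  have h2 : |p| * |q| ≤ (p ^ 2 + q ^ 2) / 2 := by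
    nlinarith [sq_nonneg (|p| - |q|), sq_abs p, sq_abs q]
  nlinarith [mul_le_mul_of_nonneg_left h2 (abs_nonneg x), sq_nonneg p]

/-- Cayley–Hamilton, `M² = xM - 1`, iterated. -/
theorem SL2C.pow_succ_apply {M : SL2C} {x : ℝ} (h : M.tr = x) (n : ℕ) (i j : Fin 2) :
    (M ^ (n + 1)) i j = chebyshevSeq x (n + 1) * M i j - chebyshevSeq x n * (1 : SL2C) i j := by
  have hd := det_eq M
  rw [tr_eq] at h
  induction n generalizing i j with
  | zero => simp [chebyshevSeq]
  | succ n ih =>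
    rw [pow_succ, mul_apply, ih, ih]
    simp only [chebyshevSeq]
    push_cast
    rw [← h]
    fin_cases i <;> fin_cases j <;> simp
    · linear_combination (-(chebyshevSeq x (n + 1) : ℂ)) * hd
    · ring
    · ring
    · linear_combination (-(chebyshevSeq x (n + 1) : ℂ)) * hd

/-- The powers of `M` are bounded, so a subsequence converges; quotients of its consecutive terms
are powers of `M` tending to 1, and discreteness makes one of them trivial. -/
theorem exists_pow_eq_one_of_abs_trace_lt_two {Γ : Subgroup PSL2C} [DiscreteTopology Γ] {M : SL2C}
    (hM : (M : PSL2C) ∈ Γ) {x : ℝ} (htr : M.tr = x) (hx : |x| < 2) :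
    ∃ k ≠ 0, (M : PSL2C) ^ k = 1 := by
  obtain ⟨C, hC⟩ := exists_abs_chebyshevSeq_le hx
  have hC0 : 0 ≤ C := (abs_nonneg _).trans (hC 0)
  let f : ℕ → Fin 2 → Fin 2 → ℂ := fun n i j => (M ^ (n + 1)) i j
  have hf : ∀ n, f n ∈ Metric.closedBall (0 : Fin 2 → Fin 2 → ℂ)
      (C * ‖fun i j => M i j‖ + C * ‖fun i j => (1 : SL2C) i j‖) := by
    intro n
    rw [mem_closedBall_zero_iff]
    have : f n = chebyshevSeq x (n + 1) • (fun i j => M i j)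
        - chebyshevSeq x n • (fun i j => (1 : SL2C) i j) := by
      ext i j
      simp only [f, SL2C.pow_succ_apply htr, Pi.sub_apply, Pi.smul_apply, Complex.real_smul]
    rw [this]
    refine (norm_sub_le _ _).trans (add_le_add ?_ ?_) <;> rw [norm_smul] <;> gcongr <;> exact hC _
  obtain ⟨L, -, φ, hφ, hL⟩ := tendsto_subseq_of_bounded Metric.isBounded_closedBall hf
  have hent : ∀ i j, Tendsto (fun n => (M ^ (φ n + 1)) i j) atTop (𝓝 (L i j)) := fun i j =>
    tendsto_pi_nhds.mp (tendsto_pi_nhds.mp hL i) j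
  have hdet : L 0 0 * L 1 1 - L 0 1 * L 1 0 = 1 := by
    refine tendsto_nhds_unique (((hent 0 0).mul (hent 1 1)).sub ((hent 0 1).mul (hent 1 0))) ?_
    simp only [SL2C.det_eq]
    exact tendsto_const_nhds
  have hlim : Tendsto (fun n => M ^ (φ n + 1)) atTop (𝓝 (SL2C.of _ _ _ _ hdet)) := by
    rw [SL2C.tendsto_iff]
    intro i j
    have := hent i j
    fin_cases i <;> fin_cases j <;> exact this
  have h1 := (hlim.comp (tendsto_add_atTop_nat 1)).mul hlim.inv
  rw [mul_inv_cancel] at h1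
  obtain ⟨n, hn⟩ := (h1.eventually (eventually_mk_eq_one Γ)).exists
  have hlt := hφ (show n < n + 1 by omega)
  refine ⟨φ (n + 1) - φ n, by omega, ?_⟩
  have h2 : M ^ (φ (n + 1) + 1) * (M ^ (φ n + 1))⁻¹ = M ^ (φ (n + 1) - φ n) := by
    rw [mul_inv_eq_iff_eq_mul, ← pow_add]
    congr 1
    omega
  have h3 := hn (show ((M ^ (φ (n + 1) + 1) * (M ^ (φ n + 1))⁻¹ : SL2C) : PSL2C) ∈ Γ by
    rw [h2]; exact Γ.pow_mem hM _)
  change ((M ^ (φ (n + 1) + 1) * (M ^ (φ n + 1))⁻¹ : SL2C) : PSL2C) = 1 at h3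
  rw [h2] at h3
  exact h3

/-! ### Descent on trace triples -/

/-- `z` and `xy - z` are the two roots of a quadratic with product `y² - x²`. Since `|x| ≥ 2`, the
relation gives `(|z| - |y|)² ≥ x² ≥ 4`, so `|z|` is well above `|y|` and is the larger root. -/
theorem abs_twist_le {x y z : ℝ} (hx : 2 ≤ |x|) (hy : 1 / 2 ≤ |y|) (hyz : |y| ≤ |z|)
    (hpos : 0 < x * y * z) (h : y ^ 2 + z ^ 2 - x * y * z = x ^ 2) :
    |x * y - z| ≤ |z| - 1 / 4 := by
  have habs : x * y * z = |x| * |y| * |z| := by rw [← abs_mul, ← abs_mul, abs_of_pos hpos]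
  have h0 : |x * y - z| = |(|x| * |y| - |z|)| := by
    rw [← sq_eq_sq_iff_abs_eq_abs]
    nlinarith [sq_abs x, sq_abs y, sq_abs z,
      show (x * y) ^ 2 = (|x| * |y|) ^ 2 by rw [mul_pow, mul_pow, sq_abs, sq_abs]]
  rw [habs, ← sq_abs x, ← sq_abs y, ← sq_abs z] at h
  rw [h0]
  generalize |x| = X at *
  generalize |y| = Y at *
  generalize |z| = Z at *
  have hXY : 2 * Y ≤ X * Y := by nlinarith
  have hZY : 2 ≤ Z - Y := by
    have : 2 ^ 2 ≤ (Z - Y) ^ 2 := by nlinarith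
    exact le_of_sq_le_sq this (by linarith)
  rw [abs_le]
  refine ⟨by linarith, ?_⟩
  by_contra! hlt
  have h1 : Z * (Z - 1 / 4) < Z * (X * Y - Z) := mul_lt_mul_of_pos_left hlt (by linarith)
  nlinarith

/-- With `xyz < 0` the relation reads `y² + z² + |xyz| = x²`, so `|yz| < |x|` and the new value has
modulus `|x| - |yz|`, where `|yz| ≥ 1/4`. -/
theorem abs_flip_le {x y z : ℝ} (hx : 2 ≤ |x|) (hy : 1 / 2 ≤ |y|) (hz : 1 / 2 ≤ |z|)
    (hneg : x * y * z < 0) (h : y ^ 2 + z ^ 2 - x * y * z = x ^ 2) :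
    |-(y * z) - x| ≤ |x| - 1 / 4 := by
  have habs : x * y * z = -(|x| * |y| * |z|) := by
    rw [← abs_mul, ← abs_mul, abs_of_neg hneg, neg_neg]
  have h0 : |-(y * z) - x| = |(|y| * |z| - |x|)| := by
    rw [← sq_eq_sq_iff_abs_eq_abs]
    nlinarith [sq_abs x, sq_abs y, sq_abs z,
      show (y * z) ^ 2 = (|y| * |z|) ^ 2 by rw [mul_pow, mul_pow, sq_abs, sq_abs]]
  rw [habs, ← sq_abs x, ← sq_abs y, ← sq_abs z] at h
  rw [h0]
  generalize |x| = X at *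
  generalize |y| = Y at *
  generalize |z| = Z at *
  have h1 : X * (Y * Z) < X * X := by nlinarith
  have h2 : Y * Z < X := lt_of_mul_lt_mul_left h1 (by linarith)
  rw [abs_le]
  constructor <;> nlinarith

section Descent

variable {ρ : PuncturedTorusGroup →* PSL2C} {σ : PuncturedTorusGroup →* SL2C}
  {u v : PuncturedTorusGroup}

/-- Trace zero means order two in the quotient, and a free group is torsion-free. -/
theorem trace_ne_zero_of_injective (hinj : Function.Injective ρ)
    (hσ : ∀ g, (σ g : PSL2C) = ρ g) (hv : v ≠ 1) : (σ v).tr ≠ 0 := by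
  intro h
  apply hv
  rw [← pow_eq_one_iff_left (two_ne_zero)]
  apply hinj
  rw [map_one, ← hσ, map_pow, SL2C.sq_eq_neg_one h, SL2C.mk_neg]
  rfl

/-- In a discrete faithful representation with parabolic commutator, simple curves have
traces bounded below. -/
theorem half_le_norm_trace (hinj : Function.Injective ρ) [DiscreteTopology ρ.range]
    (hσ : ∀ g, (σ g : PSL2C) = ρ g) (huv : ⁅u, v⁆ ≠ 1) (htr : (σ ⁅u, v⁆).tr = -2) :
    1 / 2 ≤ ‖(σ v).tr‖ := by
  have hv : v ≠ 1 := by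
    rintro rfl
    exact huv (commutatorElement_one_right u)
  have h0 := trace_ne_zero_of_injective hinj hσ hv
  have hmem : ∀ g, (σ g : PSL2C) ∈ ρ.range := fun g => ⟨g, (hσ g).symm⟩
  -- Since `[u, v] v = u v u⁻¹`, multiplying by the parabolic of trace 2 only flips the sign of the
  -- trace, so Shimizu's bound reads `1 ≤ 2 |tr v|`.
  have hdiff : (-σ ⁅u, v⁆ * σ v).tr = -(σ v).tr := by
    rw [neg_mul, SL2C.tr_neg, ← map_mul, commutatorElement_def, inv_mul_cancel_right, map_mul,
      map_mul, map_inv, SL2C.tr_conj]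
  have h := one_le_norm_trace_sub (Γ := ρ.range) (P := -σ ⁅u, v⁆) (M := σ v)
    (by rw [SL2C.mk_neg]; exact hmem _) (hmem _)
    (show (-σ ⁅u, v⁆).tr = 2 by rw [SL2C.tr_neg, htr, neg_neg])
    (fun h1 => huv <| hinj <| by
      rw [map_one, ← hσ, ← SL2C.mk_neg, h1]; rfl)
    (fun h1 => h0 <| by
      change (-σ ⁅u, v⁆ * σ v).tr = (σ v).tr at h1
      rw [hdiff] at h1
      linear_combination (-1 / 2) * h1)
  change 1 ≤ ‖(-σ ⁅u, v⁆ * σ v).tr - (σ v).tr‖ at h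
  rw [hdiff, show -(σ v).tr - (σ v).tr = -2 * (σ v).tr by ring, norm_mul, norm_neg,
    Complex.norm_two] at h
  linarith

/-- No discrete faithful representation with parabolic commutator is purely imaginary. -/
theorem not_imaginary_of_discrete_faithful (hinj : Function.Injective ρ)
    [DiscreteTopology ρ.range] (hσ : ∀ g, (σ g : PSL2C) = ρ g) (huv : ⁅u, v⁆ ≠ 1) {x y z : ℝ}
    (hx : (σ u).tr = x) (hy : (σ v).tr = Complex.I * y) (hz : (σ (u * v)).tr = Complex.I * z)
    (h : y ^ 2 + z ^ 2 - x * y * z = x ^ 2) : False := by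
  -- The factor 4 turns a drop of 1/4 into a drop of 1, so that `n` can serve as the induction
  -- variable.
  obtain ⟨n, hn⟩ := exists_nat_ge (4 * (|x| + |y| + |z|))
  induction n generalizing u v x y z with
  | zero =>
    have hu : u ≠ 1 := by
      rintro rfl
      exact huv (commutatorElement_one_left v)
    have hx0 : x ≠ 0 := fun h0 =>
      trace_ne_zero_of_injective hinj hσ hu (by rw [hx, h0, Complex.ofReal_zero])
    have := abs_pos.mpr hx0
    have := abs_nonneg y
    have := abs_nonneg z
    push_cast at hn
    linarith
  | succ n ih =>
    push_cast at hn
    have hI := Complex.I_mul_I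
    have hu : u ≠ 1 := by
      rintro rfl
      exact huv (commutatorElement_one_left v)
    have hx2 : 2 ≤ |x| := by
      by_contra! hlt
      obtain ⟨k, hk, hk1⟩ := exists_pow_eq_one_of_abs_trace_lt_two (Γ := ρ.range) (M := σ u)
        ⟨u, (hσ u).symm⟩ hx hlt
      rw [hσ, ← map_pow] at hk1
      have h1 : u ^ k = 1 := hinj (hk1.trans (map_one ρ).symm)
      exact hu ((pow_eq_one_iff_left hk).mp h1)
    have hC : (x : ℂ) ^ 2 - y ^ 2 - z ^ 2 + x * y * z = 0 := by
      have : x ^ 2 - y ^ 2 - z ^ 2 + x * y * z = 0 := by linarith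
      exact_mod_cast congrArg (fun t : ℝ => (t : ℂ)) this
    have htr : (σ ⁅u, v⁆).tr = -2 := by
      rw [map_commutatorElement, SL2C.tr_commutator, ← map_mul, hx, hy, hz]
      linear_combination hC + (y ^ 2 + z ^ 2 - x * y * z : ℂ) * hI
    have hy2 : 1 / 2 ≤ |y| := by
      have := half_le_norm_trace hinj hσ huv htr
      rwa [hy, norm_mul, Complex.norm_I, one_mul, Complex.norm_real, Real.norm_eq_abs] at this
    have hcomm : ⁅u, u * v⁆ = u * ⁅u, v⁆ * u⁻¹ := by
      rw [commutatorElement_def, commutatorElement_def]; group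
    have huv' : ⁅u, u * v⁆ ≠ 1 := by rwa [hcomm, ne_eq, conj_eq_one_iff]
    have hz2 : 1 / 2 ≤ |z| := by
      have := half_le_norm_trace hinj hσ huv'
        (by rw [hcomm, map_mul, map_mul, map_inv, SL2C.tr_conj, htr])
      rwa [hz, norm_mul, Complex.norm_I, one_mul, Complex.norm_real, Real.norm_eq_abs] at this
    rcases lt_or_ge 0 (x * y * z) with hpos | hneg
    · rcases le_total |y| |z| with hle | hle
      -- The new pair is `(u, u⁻¹v)`, with product `v`: the traces become `(x, xy - z, y)`.
      · have hcomm' : ⁅u, u⁻¹ * v⁆ = u⁻¹ * ⁅u, v⁆ * (u⁻¹)⁻¹ := by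
          rw [commutatorElement_def, commutatorElement_def]; group
        refine ih (u := u) (v := u⁻¹ * v) (x := x) (y := x * y - z) (z := y)
          (by rwa [hcomm', ne_eq, conj_eq_one_iff]) hx ?_ ?_ (by linear_combination h) ?_
        · have := SL2C.tr_mul_add_tr_inv_mul (σ u) (σ v)
          rw [← map_mul, hx, hy, hz] at this
          rw [map_mul, map_inv]
          push_cast
          linear_combination this
        · rw [mul_inv_cancel_left, hy]
        · linarith [abs_twist_le hx2 hy2 hle hpos h]
      -- The inverse twist: the pair `(u, uv)` has traces `(x, z, xz - y)`.
      · refine ih (u := u) (v := u * v) (x := x) (y := z) (z := x * z - y)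
          huv' hx hz ?_ (by linear_combination h) ?_
        · have := SL2C.tr_mul_add_tr_inv_mul (σ u) (σ (u * v))
          rw [← map_inv, ← map_mul, ← map_mul, inv_mul_cancel_left, hx, hy, hz] at this
          push_cast
          linear_combination this
        · linarith [abs_twist_le (x := x) (y := z) (z := y) hx2 hz2 hle
            (by linarith) (by linarith)]
    · have hneg' : x * y * z < 0 := lt_of_le_of_ne hneg <| by
        have hne : ∀ t : ℝ, 1 / 2 ≤ |t| → t ≠ 0 := fun t ht => abs_pos.mp (by linarith)
        exact mul_ne_zero (mul_ne_zero (hne x (by linarith)) (hne y hy2)) (hne z hz2)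
      -- Inverting `v` makes the product of the new pair `uv`, so `y` and `z` are kept and only `x`
      -- changes, to `(iy)(iz) - x`.
      have hcomm' : ⁅u * v * v, v⁻¹⁆ = v⁻¹ * ⁅u, v⁆⁻¹ * (v⁻¹)⁻¹ := by
        rw [commutatorElement_def, commutatorElement_def]; group
      refine ih (u := u * v * v) (v := v⁻¹) (x := -(y * z) - x) (y := y) (z := z)
        (by rwa [hcomm', ne_eq, conj_eq_one_iff, inv_eq_one]) ?_ ?_ ?_
        (by linear_combination h) ?_
      · have := SL2C.tr_mul_add_tr_inv_mul (σ v) (σ (u * v))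
        rw [show ((σ v)⁻¹ * σ (u * v)).tr = (σ u).tr by
            rw [map_mul, SL2C.tr_mul_comm, mul_inv_cancel_right],
          SL2C.tr_mul_comm, ← map_mul, hx, hy, hz] at this
        push_cast
        linear_combination this + y * z * hI
      · rw [map_inv, SL2C.tr_inv, hy]
      · rw [mul_inv_cancel_right, hz]
      · linarith [abs_flip_le hx2 hy2 hz2 hneg' h]

end Descent

/-! ### The lines `|Im τ| = π` -/

/-- A shift by `±iπ/2` turns `cosh` into `±i sinh`, while `tr a` does not involve `τ`. -/
theorem fnLift_imaginary {l : ℝ} (hl : 0 < l) {τ : ℂ} (hτ : |τ.im| = Real.pi) :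
    ∃ x y z : ℝ, (fnLift l τ hl PuncturedTorusGroup.a).tr = x ∧
      (fnLift l τ hl PuncturedTorusGroup.b).tr = Complex.I * y ∧
      (fnLift l τ hl (PuncturedTorusGroup.a * PuncturedTorusGroup.b)).tr = Complex.I * z ∧
      y ^ 2 + z ^ 2 - x * y * z = x ^ 2 := by
  obtain ⟨h1, h2, h3⟩ := fnLift_traces l τ hl
  obtain ⟨ε, hε, hτε⟩ : ∃ ε : ℝ, ε ^ 2 = 1 ∧ τ.im = ε * Real.pi := by
    rcases abs_eq Real.pi_pos.le |>.mp hτ with h | h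
    · exact ⟨1, by norm_num, by rw [h, one_mul]⟩
    · exact ⟨-1, by norm_num, by rw [h, neg_one_mul]⟩
  have hcosh : ∀ s : ℝ, Complex.cosh (s + ε * (Real.pi / 2) * Complex.I)
      = Complex.I * (ε * Real.sinh s : ℝ) := by
    intro s
    have hε' : ε = 1 ∨ ε = -1 := sq_eq_one_iff.mp hε
    rw [Complex.cosh_add, Complex.cosh_mul_I, Complex.sinh_mul_I]
    rcases hε' with rfl | rfl <;> simp <;> ring
  have hre : τ / 2 = ((τ.re / 2 : ℝ) : ℂ) + ε * (Real.pi / 2) * Complex.I := by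
    conv_lhs => rw [← Complex.re_add_im τ, hτε]
    push_cast
    ring
  have hre' : (τ + l) / 2 = ((τ.re / 2 + l / 2 : ℝ) : ℂ) + ε * (Real.pi / 2) * Complex.I := by
    rw [add_div, hre]
    push_cast
    ring
  have hsinh : 0 < Real.sinh (l / 2) := Real.sinh_pos_iff.mpr (by linarith)
  have hcosh0 : 0 < Real.cosh (l / 2) := Real.cosh_pos _
  refine ⟨2 * Real.cosh (l / 2), 2 * (ε * Real.sinh (τ.re / 2)) / Real.tanh (l / 2),
    2 * (ε * Real.sinh (τ.re / 2 + l / 2)) / Real.tanh (l / 2), ?_, ?_, ?_, ?_⟩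
  · rw [SL2C.tr, h1]
    push_cast
    rfl
  · rw [SL2C.tr, h2, hre, hcosh]
    push_cast
    ring
  · rw [SL2C.tr, h3, hre', hcosh]
    push_cast
    ring
  · rw [Real.tanh_eq_sinh_div_cosh, Real.sinh_add]
    have e1 := Real.cosh_sq (l / 2)
    have e2 := Real.cosh_sq (τ.re / 2)
    generalize Real.sinh (l / 2) = S at *
    generalize Real.cosh (l / 2) = C at *
    generalize Real.sinh (τ.re / 2) = s at *
    generalize Real.cosh (τ.re / 2) = c at *
    field_simp
    linear_combination (s ^ 2 + (s * C + S * c) ^ 2 - 2 * s * C * (s * C + S * c)) * hε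
      + S ^ 2 * e2 - s ^ 2 * e1

theorem psiFN_notMem_QF {l : ℝ} (hl : 0 < l) {τ : ℂ} (hτ : |τ.im| = Real.pi) :
    psiFN l τ hl ∉ QF := by
  rintro ⟨ρ, hρ, hinj, hdisc, -⟩
  obtain ⟨h, hh⟩ := Quotient.exact hρ
  obtain ⟨H, rfl⟩ := QuotientGroup.mk_surjective h
  obtain ⟨x, y, z, hx, hy, hz, hxyz⟩ := fnLift_imaginary hl hτ
  let σ : PuncturedTorusGroup →* SL2C := (MulAut.conj H⁻¹).toMonoidHom.comp (fnLift l τ hl)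
  have hσ : ∀ g, (σ g : PSL2C) = ρ.1 g := by
    intro g
    have h1 : fnRep l τ hl g = (H : PSL2C) * ρ.1 g * (H : PSL2C)⁻¹ := hh g
    have h2 : (σ g : PSL2C) = (H : PSL2C)⁻¹ * fnRep l τ hl g * ((H : PSL2C)⁻¹)⁻¹ := rfl
    rw [h2, h1]
    group
  have htr : ∀ g, (σ g).tr = (fnLift l τ hl g).tr := fun g => SL2C.tr_conj H⁻¹ _
  refine not_imaginary_of_discrete_faithful (u := PuncturedTorusGroup.a)
    (v := PuncturedTorusGroup.b) hinj hσ
    (fun h1 => ρ.2.1.1 ((congrArg ρ.1 h1).trans (map_one ρ.1)))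
    ((htr _).trans hx) ((htr _).trans hy) ((htr _).trans hz) hxyz

/-! ### Fenchel–Nielsen normal form -/

theorem SL2C.eq_or_eq_neg_of_mk_eq {M N : SL2C} (h : (M : PSL2C) = N) : N = M ∨ N = -M := by
  obtain ⟨r, hr, hM⟩ := Matrix.SpecialLinearGroup.mem_center_iff.mp (QuotientGroup.eq.mp h)
  rw [Fintype.card_fin] at hr
  rcases sq_eq_one_iff.mp hr with rfl | rfl
  · left
    have h1 : M⁻¹ * N = 1 := Subtype.ext (by rw [← hM]; simp)
    exact (inv_mul_eq_one.mp h1).symm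
  · right
    have h1 : M⁻¹ * N = -1 := by
      apply ext_entries <;> rw [← hM, Matrix.SpecialLinearGroup.coe_neg] <;> simp
    rw [inv_mul_eq_iff_eq_mul, mul_neg, mul_one] at h1
    exact h1

theorem SL2C.ext_of_apply_one_zero_ne {M N : SL2C} (h : N 1 0 ≠ 0) (h00 : M 0 0 = N 0 0)
    (h10 : M 1 0 = N 1 0) (h11 : M 1 1 = N 1 1) : M = N := by
  refine ext_entries h00 ?_ h10 h11
  have h1 := det_eq M
  have h2 := det_eq N
  rw [h00, h10, h11] at h1
  exact mul_right_cancel₀ h (by linear_combination h2 - h1)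

/-- The commutator trace of an upper triangular matrix `M` and a matrix `B`, in terms of the
diagonal entries of `B` in an eigenbasis of `M`. -/
theorem SL2C.tr_commutator_of_upper {M B : SL2C} {E k : ℂ} (hE : E ≠ 0)
    (h00 : M 0 0 = E) (h11 : M 1 1 = E⁻¹) (h10 : M 1 0 = 0) (hk : M 0 1 * E = k * (E ^ 2 - 1)) :
    (⁅M, B⁆ : SL2C).tr * E ^ 2 = (E ^ 2 + 1) ^ 2 - 2 * E ^ 2
      - (B 0 0 + k * B 1 0) * (B 1 1 - k * B 1 0) * (E ^ 2 - 1) ^ 2 := by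
  have h01 : M 0 1 = k * (E - E⁻¹) := by
    field_simp
    linear_combination hk
  rw [tr_commutator]
  simp only [tr_eq, mul_apply, h00, h01, h10, h11]
  field_simp
  ring

theorem exp_half_add_two_pi (tau : ℂ) :
    Complex.exp ((tau + 2 * Real.pi * Complex.I) / 2) = -Complex.exp (tau / 2) := by
  rw [add_div, Complex.exp_add, show 2 * (Real.pi : ℂ) * Complex.I / 2 = Real.pi * Complex.I by
    ring, Complex.exp_pi_mul_I, mul_neg_one]

theorem fnB_add_two_pi (lam tau : ℂ) (h : 0 < lam.re) :
    fnB lam (tau + 2 * Real.pi * Complex.I) h = -fnB lam tau h := by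
  apply SL2C.ext_entries <;> rw [Matrix.SpecialLinearGroup.coe_neg] <;>
    simp [fnB, exp_half_add_two_pi, div_neg, neg_div]

/-- Commutator trace -2 fixes the product of the diagonal entries of `B` in an eigenbasis of `M`;
their remaining freedom is the single parameter `T`. The matrix `T` describes is only matched for
those `tau` with `exp (tau / 2) = T`. -/
theorem exists_conj_fenchelNielsen {lam : ℂ} (h : 0 < lam.re) {M B : SL2C}
    (h00 : M 0 0 = Complex.exp (lam / 2)) (h11 : M 1 1 = Complex.exp (-lam / 2))
    (h10 : M 1 0 = 0) (htr : (⁅M, B⁆ : SL2C).tr = -2) :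
    ∃ (G : SL2C) (T : ℂ), T ≠ 0 ∧ G * M * G⁻¹ = fnA lam ∧
      ∀ tau, Complex.exp (tau / 2) = T → G * B * G⁻¹ = fnB lam tau h := by
  have hE := exp_half_sq_sub_one_ne h
  have hE' := exp_half_sq_add_one_ne h
  have hE0 := Complex.exp_ne_zero (lam / 2)
  rw [neg_div, Complex.exp_neg] at h11
  have hA : (fnA lam : Matrix (Fin 2) (Fin 2) ℂ) = !![Complex.exp (lam / 2),
    2 * (Complex.exp (lam / 2))⁻¹; 0, (Complex.exp (lam / 2))⁻¹] := rfl
  have hB : ∀ tau, (fnB lam tau h : Matrix (Fin 2) (Fin 2) ℂ) =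
    !![((Complex.exp (lam / 2) ^ 2 + 1) * Complex.exp (tau / 2) ^ 2 + 2)
        / (Complex.exp (tau / 2) * (Complex.exp (lam / 2) ^ 2 - 1)),
      -2 * (Complex.exp (tau / 2) ^ 2 + 1)
        / (Complex.exp (tau / 2) * (Complex.exp (lam / 2) ^ 2 - 1));
      (-Complex.exp (lam / 2) ^ 2 + 1)
        / (Complex.exp (tau / 2) * (Complex.exp (lam / 2) ^ 2 - 1)),
      (Complex.exp (lam / 2) ^ 2 - 1)
        / (Complex.exp (tau / 2) * (Complex.exp (lam / 2) ^ 2 - 1))] := fun _ => rfl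
  generalize Complex.exp (lam / 2) = E at *
  obtain ⟨k, hk⟩ : ∃ k, M 0 1 * E = k * (E ^ 2 - 1) := ⟨_, (div_mul_cancel₀ _ hE).symm⟩
  have hps := SL2C.tr_commutator_of_upper (B := B) hE0 h00 h11 h10 hk
  rw [htr] at hps
  have hdet := SL2C.det_eq B
  obtain ⟨T, hT⟩ : ∃ T, (B 0 0 + k * B 1 0) * (E ^ 2 - 1) = T * (E ^ 2 + 1) :=
    ⟨_, (div_mul_cancel₀ _ hE').symm⟩
  have hs : T * ((B 1 1 - k * B 1 0) * (E ^ 2 - 1)) = E ^ 2 + 1 := by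
    apply mul_right_cancel₀ hE'
    linear_combination hps - (B 1 1 - k * B 1 0) * (E ^ 2 - 1) * hT
  have hT0 : T ≠ 0 := by
    rintro rfl
    exact hE' (by rw [← hs, zero_mul])
  have hr : B 1 0 ≠ 0 := by
    intro hr
    rw [hr] at hps hdet
    have : 4 * E ^ 2 = 0 := by linear_combination -hps + (E ^ 2 - 1) ^ 2 * hdet
    exact hE0 (by simpa using this)
  obtain ⟨c, hc⟩ := IsAlgClosed.exists_pow_nat_eq (-(B 1 0 * T)) (n := 2) (by norm_num)
  have hc0 : c ≠ 0 := by
    rintro rfl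
    rw [zero_pow two_ne_zero, eq_comm, neg_eq_zero] at hc
    exact mul_ne_zero hr hT0 hc
  -- `G` fixes ∞ and sends the other fixed point `-k` of `M` to that of `fnA`, namely `-2 / (E² -
  -- 1)`; the choice of `c²` makes the lower left entry of the conjugate of `B` equal to `-1 / T`.
  let G : SL2C := SL2C.of c (c * k - 2 / (E ^ 2 - 1) / c) 0 c⁻¹ (by field_simp; ring)
  have hG : (G : Matrix (Fin 2) (Fin 2) ℂ) = !![c, c * k - 2 / (E ^ 2 - 1) / c; 0, c⁻¹] := rfl
  have h01 : M 0 1 = k * (E ^ 2 - 1) / E := by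
    field_simp
    exact hk
  refine ⟨G, T, hT0, ?_, fun tau htau => ?_⟩
  · rw [mul_inv_eq_iff_eq_mul]
    apply SL2C.ext_entries <;> simp [SL2C.mul_apply, hG, hA, h00, h10, h11, h01]
    · ring
    · field_simp
      ring
    · ring
  · rw [mul_inv_eq_iff_eq_mul]
    have hb10 : B 1 0 = -c ^ 2 / T := by
      field_simp
      linear_combination hc
    have hb00 : B 0 0 = T * (E ^ 2 + 1) / (E ^ 2 - 1) - k * B 1 0 := by
      field_simp
      linear_combination hT
    have hb11 : B 1 1 = (E ^ 2 + 1) / (T * (E ^ 2 - 1)) + k * B 1 0 := by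
      field_simp
      linear_combination hs
    have hB' := hB tau
    rw [htau] at hB'
    apply SL2C.ext_of_apply_one_zero_ne <;>
      simp only [SL2C.mul_apply, hG, hB', hb00, hb11, hb10, Matrix.of_apply, Matrix.cons_val',
        Matrix.cons_val_zero, Matrix.cons_val_one, Matrix.cons_val_fin_one]
    · rw [mul_zero, add_zero]
      refine mul_ne_zero (div_ne_zero (fun h0 : -E ^ 2 + 1 = 0 => hE ?_)
        (mul_ne_zero hT0 hE)) hc0
      linear_combination -h0
    · field_simp
      ring
    · field_simp
      ring
    · field_simp
      ring

theorem fixes_of_fixes_generators {ρ : PuncturedTorusGroup →* PSL2C}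
    {ξ : Projectivization ℂ (Fin 2 → ℂ)} (ha : ρ PuncturedTorusGroup.a • ξ = ξ)
    (hb : ρ PuncturedTorusGroup.b • ξ = ξ) (g : PuncturedTorusGroup) : ρ g • ξ = ξ := by
  induction g using FreeGroup.induction_on with
  | C1 => rw [map_one, one_smul]
  | of i => fin_cases i <;> assumption
  | inv_of i hi => rw [map_inv, inv_smul_eq_iff, hi]
  | mul x y hx hy => rw [map_mul, mul_smul, hy, hx]

theorem SL2C.mk_smul_eq {M : SL2C} {v : Fin 2 → ℂ} (hv : v ≠ 0) {c : ℂ}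
    (h0 : M 0 0 * v 0 + M 0 1 * v 1 = c * v 0) (h1 : M 1 0 * v 0 + M 1 1 * v 1 = c * v 1) :
    (M : PSL2C) • Projectivization.mk ℂ v hv = Projectivization.mk ℂ v hv := by
  change M • Projectivization.mk ℂ v hv = Projectivization.mk ℂ v hv
  rw [Projectivization.smul_mk, Projectivization.mk_eq_mk_iff']
  refine ⟨c, ?_⟩
  symm
  change (M : Matrix (Fin 2) (Fin 2) ℂ).mulVec v = c • v
  ext i
  fin_cases i <;> simpa [Matrix.mulVec, dotProduct, Fin.sum_univ_two]

/-- A pair with commutator of trace two, one member of which is hyperbolic and upper triangular,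
has a common fixed point. -/
theorem exists_common_fixed_point {M B : SL2C} {E : ℂ} (hE : E ≠ 0) (hE1 : E ^ 2 - 1 ≠ 0)
    (h00 : M 0 0 = E) (h11 : M 1 1 = E⁻¹) (h10 : M 1 0 = 0) (htr : (⁅M, B⁆ : SL2C).tr = 2) :
    ∃ ξ : Projectivization ℂ (Fin 2 → ℂ), (M : PSL2C) • ξ = ξ ∧ (B : PSL2C) • ξ = ξ := by
  obtain ⟨k, hk⟩ : ∃ k, M 0 1 * E = k * (E ^ 2 - 1) := ⟨_, (div_mul_cancel₀ _ hE1).symm⟩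
  have hps := SL2C.tr_commutator_of_upper (B := B) hE h00 h11 h10 hk
  rw [htr] at hps
  have hdet := SL2C.det_eq B
  by_cases hr : B 1 0 = 0
  · have hv : ![(1 : ℂ), 0] ≠ 0 := fun h => by simpa using congrFun h 0
    exact ⟨_, SL2C.mk_smul_eq hv (c := E) (by simp [h00]) (by simp [h10]),
      SL2C.mk_smul_eq hv (c := B 0 0) (by simp) (by simp [hr])⟩
  -- In an eigenbasis of `M` the diagonal product of `B` is 1, so its off-diagonal product is 0; as
  -- `B 1 0 ≠ 0`, the eigenvector `(-k, 1)` of `M` is one of `B` too.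
  · have hv : ![-k, (1 : ℂ)] ≠ 0 := fun h => by simpa using congrFun h 1
    have hps1 : (B 0 0 + k * B 1 0) * (B 1 1 - k * B 1 0) = 1 := by
      apply mul_right_cancel₀ (pow_ne_zero 2 hE1)
      linear_combination hps
    refine ⟨_, SL2C.mk_smul_eq hv (c := E⁻¹) ?_ (by simp [h10, h11]),
      SL2C.mk_smul_eq hv (c := B 1 1 - k * B 1 0) ?_ ?_⟩
    · simp [h00]
      field_simp
      linear_combination hk
    · simp
      apply mul_right_cancel₀ hr
      linear_combination hps1 - hdet
    · simp
      ring

theorem exists_psiFN_eq {l : ℝ} (hl : 0 < l) {ρ : PuncturedTorusGroup →* PSL2C}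
    (hpar : IsParabolicElt (ρ PuncturedTorusGroup.peripheral)) (hirr : IsIrreducibleRep ρ)
    (hρ : HasComplexLength (ρ PuncturedTorusGroup.a) l) :
    ∃ τ : ℂ, -Real.pi < τ.im ∧ τ.im ≤ Real.pi ∧ psiFN l τ hl = Xpar.mk ⟨ρ, hpar, hirr⟩ := by
  have hl' : 0 < (l : ℂ).re := hl
  obtain ⟨h, M, hM, h10, h00, h11⟩ := hρ
  obtain ⟨B, hB⟩ := QuotientGroup.mk_surjective (h⁻¹ * ρ PuncturedTorusGroup.b * h)
  change (B : PSL2C) = _ at hB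
  have hM' : (M : PSL2C) = h⁻¹ * ρ PuncturedTorusGroup.a * h := by rw [hM]; group
  have htr : (⁅M, B⁆ : SL2C).tr = -2 := by
    obtain ⟨P, hP, hPtr⟩ := hpar.2
    obtain ⟨H, rfl⟩ := QuotientGroup.mk_surjective h
    have h1 : (P : PSL2C) = (H * ⁅M, B⁆ * H⁻¹ : SL2C) := by
      have h2 : ((H * ⁅M, B⁆ * H⁻¹ : SL2C) : PSL2C)
        = (H : PSL2C) * ((M : PSL2C) * B * (M : PSL2C)⁻¹ * (B : PSL2C)⁻¹) * (H : PSL2C)⁻¹ := rfl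
      rw [h2, hP, hB, hM', show PuncturedTorusGroup.peripheral
        = ⁅PuncturedTorusGroup.a, PuncturedTorusGroup.b⁆ from rfl, map_commutatorElement,
        commutatorElement_def]
      group
    have h3 : (⁅M, B⁆ : SL2C).tr ^ 2 = 4 := by
      rw [← hPtr, ← SL2C.tr_conj H]
      rcases SL2C.eq_or_eq_neg_of_mk_eq h1 with h | h <;> rw [h]
      rw [SL2C.tr_neg, neg_sq]
    have h4 : ((⁅M, B⁆ : SL2C).tr - 2) * ((⁅M, B⁆ : SL2C).tr + 2) = 0 := by
      linear_combination h3
    rcases mul_eq_zero.mp h4 with h5 | h5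
    · exfalso
      obtain ⟨ξ, hξM, hξB⟩ := exists_common_fixed_point (Complex.exp_ne_zero _)
        (exp_half_sq_sub_one_ne hl') h00 (by rw [h11, neg_div, Complex.exp_neg]) h10
        (sub_eq_zero.mp h5)
      refine hirr ⟨(H : PSL2C) • ξ, fixes_of_fixes_generators ?_ ?_⟩
      · rw [hM', mul_smul, mul_smul, inv_smul_eq_iff] at hξM
        exact hξM
      · rw [hB, mul_smul, mul_smul, inv_smul_eq_iff] at hξB
        exact hξB
    · exact eq_neg_of_add_eq_zero_left h5
  obtain ⟨G, T, hT0, hGM, hGB⟩ := exists_conj_fenchelNielsen hl' h00 h11 h10 htr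
  -- The principal logarithm of `T²` places `Im τ` in `(-π, π]`, at the price of a sign in `exp (τ /
  -- 2) = ±T`. The sign only negates the matrix of `b`, which is invisible in the quotient.
  refine ⟨Complex.log (T ^ 2), Complex.neg_pi_lt_log_im _, Complex.log_im_le_pi _, ?_⟩
  set τ := Complex.log (T ^ 2)
  have hτ : Complex.exp (τ / 2) = T ∨ Complex.exp (τ / 2) = -T := by
    rw [← sq_eq_sq_iff_eq_or_eq_neg, ← Complex.exp_nat_mul]
    rw [show ((2 : ℕ) : ℂ) * (τ / 2) = τ by push_cast; ring]
    exact Complex.exp_log (pow_ne_zero 2 hT0)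
  have hb : fnRep l τ hl PuncturedTorusGroup.b = (G : PSL2C) * B * (G : PSL2C)⁻¹ := by
    change (fnLift l τ hl PuncturedTorusGroup.b : PSL2C) = (G * B * G⁻¹ : SL2C)
    rw [fnLift_b]
    rcases hτ with h | h
    · rw [hGB τ h]
    · rw [hGB (τ + 2 * Real.pi * Complex.I) (by rw [exp_half_add_two_pi, h, neg_neg]),
        fnB_add_two_pi, SL2C.mk_neg]
  have ha : fnRep l τ hl PuncturedTorusGroup.a = (G : PSL2C) * M * (G : PSL2C)⁻¹ := by
    change (fnLift l τ hl PuncturedTorusGroup.a : PSL2C) = (G * M * G⁻¹ : SL2C)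
    rw [fnLift_a, hGM]
  have hconj : (MulAut.conj (h * (G : PSL2C)⁻¹)).toMonoidHom.comp (fnRep l τ hl) = ρ := by
    refine FreeGroup.ext_hom _ _ fun i => ?_
    fin_cases i
    · change h * (G : PSL2C)⁻¹ * fnRep l τ hl PuncturedTorusGroup.a * (h * (G : PSL2C)⁻¹)⁻¹
        = ρ PuncturedTorusGroup.a
      rw [ha, hM']
      group
    · change h * (G : PSL2C)⁻¹ * fnRep l τ hl PuncturedTorusGroup.b * (h * (G : PSL2C)⁻¹)⁻¹
        = ρ PuncturedTorusGroup.b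
      rw [hb, hB]
      group
  exact Quotient.sound ⟨h * (G : PSL2C)⁻¹, fun g => (DFunLike.congr_fun hconj g).symm⟩

theorem mainTheorem10 (l : ℝ) (hl : 0 < l) :
    (∀ τ : ℂ, |τ.im| = Real.pi → psiFN l τ hl ∉ QF) ∧
    QFSlice l ⊆ (fun τ : ℂ => psiFN l τ hl) '' {τ : ℂ | -Real.pi < τ.im ∧ τ.im < Real.pi} ∧
    QFSliceCoord l hl ⊆ {(l : ℂ)} ×ˢ {τ : ℂ | -Real.pi < τ.im ∧ τ.im < Real.pi} := by
  refine ⟨fun τ hτ => psiFN_notMem_QF hl hτ, ?_, ?_⟩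
  · rintro _ ⟨hqf, ρ, rfl, hρ⟩
    obtain ⟨τ, h1, h2, h3⟩ := exists_psiFN_eq hl ρ.2.1 ρ.2.2 hρ
    refine ⟨τ, ⟨h1, lt_of_le_of_ne h2 fun h4 => ?_⟩, h3⟩
    exact psiFN_notMem_QF hl (by rw [h4, abs_of_pos Real.pi_pos]) (h3 ▸ hqf)
  · rintro ⟨l', τ⟩ ⟨rfl, h1, h2, hqf, -⟩
    refine ⟨rfl, lt_of_le_of_ne h1 fun h4 => ?_, h2⟩
    exact psiFN_notMem_QF hl (by rw [← h4, abs_neg, abs_of_pos Real.pi_pos]) hqf
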